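/- Let $n\ge 1$, let $Q_n$ be the $n$-dimensional Hamming cube with vertex set $V=\{0,1\}^n$ (two vertices being adjacent when they differ in exactly one coordinate), let $\mu$ be the uniform probability measure on $V$, and let $\beta=\log_2(3/2)$. For $x\in V$ and $i\in[n]=\{1,\dots,n\}$ let $x^i$ be the vertex obtained from $x$ by flipping its $i$-th coordinate. For $A,B\subseteq V$ let $\nabla(A,B)$ be the set of edges $(x,y)$ of $Q_n$ with $x\in A$, $y\in B$, and let $\nabla_iA=\{(x,x^i):x\in A,\ x^i\notin A\}$. A codimension-$k$ subcube is a set $\{x\in V: x_i=z_i\ \forall i\in I\}$, where $I\subseteq[n]$, $|I|=k$ and $z\in\{0,1\}^I$. **Theorem.** There is an absolute constant $K>0$ such that the following holds for each $k\in\{1,2\}$, every integer $n\ge k$ and every real $\varepsilon>0$. Let $(A,B,W)$ be a partition of $V$ (parts may be empty) with $$(1-\varepsilon)2^{-k}\le\mu(A)\le(1+\varepsilon)2^{-k},\qquad \mu(W)\le\varepsilon n^{-\beta},\qquad |\nabla(A,B)|<(1+\varepsilon)\,k\,2^{n-k}.$$ Then there is a set $I\subseteq[n]$ with $|I|=k$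 such that $$\bigl||\nabla_iA|-2^{n-k}\bigr|\le K\varepsilon\,2^{n-k}\qquad\text{for all } i\in I,$$ and there is a codimension-$k$ subcube $C$ with $\mu(C\,\Delta\,A)\le K\varepsilon$. -/

import Mathlib

/-- The vertex set `{0,1}^n` of the `n`-dimensional Hamming cube `Q_n`. -/
abbrev Cube (n : ℕ) : Type := Fin n → Bool

/-- The Hamming cube `Q_n`: two vertices are adjacent iff they differ in exactly one coordinate. -/
def cubeGraph (n : ℕ) : SimpleGraph (Cube n) where
  Adj x y := hammingDist x y = 1
  symm := ⟨fun x y h => by rw [hammingDist_comm]; exact h⟩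
  loopless := ⟨fun x h => by simp at h⟩

instance (n : ℕ) : DecidableRel (cubeGraph n).Adj :=
  fun x y => inferInstanceAs (Decidable (hammingDist x y = 1))

/-- The vertex `x^i` obtained from `x` by flipping its `i`-th coordinate. -/
def flipCoord {n : ℕ} (x : Cube n) (i : Fin n) : Cube n := Function.update x i (!(x i))

/-- The uniform probability measure of a set of vertices of `Q_n`. -/
noncomputable def cubeMeasure {n : ℕ} (A : Finset (Cube n)) : ℝ := (A.card : ℝ) / 2 ^ n

/-- The constant `β = log₂ (3/2)`. -/
noncomputable def isoBeta : ℝ := Real.logb 2 (3 / 2)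

/-- `(A, B, W)` is a partition of the vertex set of `Q_n` (parts may be empty). -/
def IsCubePartition {n : ℕ} (A B W : Finset (Cube n)) : Prop :=
  Disjoint A B ∧ Disjoint A W ∧ Disjoint B W ∧ A ∪ B ∪ W = Finset.univ

/-- `∇(A, B)`: the edges `(x, y)` of `Q_n` with `x ∈ A` and `y ∈ B`. -/
def edgesBetween {n : ℕ} (A B : Finset (Cube n)) : Finset (Cube n × Cube n) :=
  (A ×ˢ B).filter fun p => (cubeGraph n).Adj p.1 p.2

/-- `∇_i A`: the pairs `(x, x^i)` with `x ∈ A` and `x^i ∉ A`. -/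
def dirBoundary {n : ℕ} (i : Fin n) (A : Finset (Cube n)) : Finset (Cube n × Cube n) :=
  (A.filter fun x => flipCoord x i ∉ A).image fun x => (x, flipCoord x i)

/-- `C` is a codimension-`k` subcube of `Q_n`: the set of vertices having prescribed values on
a set of `k` coordinates. -/
def IsSubcube {n : ℕ} (k : ℕ) (C : Finset (Cube n)) : Prop :=
  ∃ I : Finset (Fin n), I.card = k ∧
    ∃ z : I → Bool, C = Finset.univ.filter fun x : Cube n => ∀ i : I, x i = z i

/-! Let h(x) count the neighbours of x outside A ∪ W. The inequality `isoperimetric` is an equality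
for subcubes of codimension 1 and 2. On A the sum of h is at most |∇(A,B)|, and W contributes at
most ε to the functional because h ≤ n. Since h^β lies below a line touching it at h = k, with a gap
elsewhere, the edge hypothesis is compatible with isoperimetry only if h = k on nearly all of A ∪ W
(`nearSubcube_union`).

An influential direction is then needed. `variance_le_condEnergy` bounds the variance by a
conditional energy of the edges at points with h = k. Used for the order of the coordinates and for
its reverse, it gives through `sum_sq_avg_edgeInd_ge` a lower bound on the sum of squared
influences. The total influence is about 2k·2^(-k) = 1, so some direction has large influence
(`exists_avg_edgeInd_ge`). Cutting along it lowers the functional so much that isoperimetry in the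
slices makes one of them small (`exists_slice_le`), and then of measure O(η)
(`NearSubcube.slice_le`). The other slice is nearly full if k = 1, and satisfies the k = 1
hypothesis if k = 2 (`NearSubcube.slice_not`). -/

/-! ### The weight h^β: increments and touching lines -/

/-- The power `h ^ β` of a natural number. -/
noncomputable def degWeight (h : ℕ) : ℝ := (h : ℝ) ^ isoBeta

theorem isoBeta_pos : 0 < isoBeta := Real.logb_pos (by norm_num) (by norm_num)

theorem two_rpow_isoBeta : (2 : ℝ) ^ isoBeta = 3 / 2 :=
  Real.rpow_logb (by norm_num) (by norm_num) (by norm_num)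

theorem one_le_two_mul_isoBeta : 1 ≤ 2 * isoBeta := by
  have h : (1 / 2 : ℝ) ≤ isoBeta := by
    unfold isoBeta
    rw [Real.le_logb_iff_rpow_le (by norm_num) (by norm_num), ← Real.sqrt_eq_rpow,
      Real.sqrt_le_iff]
    norm_num
  linarith

theorem isoBeta_le : isoBeta ≤ 3 / 5 := by
  unfold isoBeta
  rw [Real.logb_le_iff_le_rpow (by norm_num) (by norm_num)]
  refine le_of_pow_le_pow_left₀ (n := 5) (by norm_num) (by positivity) ?_
  rw [← Real.rpow_natCast ((2 : ℝ) ^ (3 / 5 : ℝ)), ← Real.rpow_mul (by norm_num)]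
  norm_num

theorem degWeight_zero : degWeight 0 = 0 := by
  simp [degWeight, Real.zero_rpow isoBeta_pos.ne']

theorem degWeight_one : degWeight 1 = 1 := by simp [degWeight]

theorem degWeight_two : degWeight 2 = 3 / 2 := by
  simpa [degWeight] using two_rpow_isoBeta

theorem degWeight_nonneg (h : ℕ) : 0 ≤ degWeight h := by unfold degWeight; positivity

theorem degWeight_mono : Monotone degWeight := fun a b hab =>
  Real.rpow_le_rpow (by positivity) (by exact_mod_cast hab) isoBeta_pos.le

theorem one_add_half_le_rpow {w : ℝ} (h0 : 0 ≤ w) (h1 : w ≤ 1) :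
    1 + w / 2 ≤ (1 + w) ^ isoBeta := by
  have hc := Real.concaveOn_rpow isoBeta_pos.le (by linarith [isoBeta_le])
  have := hc.2 (x := 1) (y := 2) (by simp) (by simp) (sub_nonneg.2 h1) h0 (by ring)
  simp only [smul_eq_mul, Real.one_rpow, two_rpow_isoBeta] at this
  have e : (1 - w) * 1 + w * 2 = 1 + w := by ring
  rw [e] at this
  linarith

/-- Concavity gives (1 + 1/h)^β ≥ 1 + 1/(2h), and β ≥ 1/2 gives h^(2β) ≥ h. -/
theorem degWeight_succ_ge {h : ℕ} (hh : 1 ≤ h) :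
    degWeight h + 1 / (2 * degWeight h) ≤ degWeight (h + 1) := by
  have hp : (0 : ℝ) < h := by exact_mod_cast hh
  have h1 : (1 : ℝ) ≤ h := by exact_mod_cast hh
  set w : ℝ := (h : ℝ)⁻¹ with hw
  have hw1 : w ≤ 1 := inv_le_one_of_one_le₀ h1
  have e1 : degWeight (h + 1) = degWeight h * (1 + w) ^ isoBeta := by
    unfold degWeight
    rw [← Real.mul_rpow hp.le (by positivity)]
    congr 1
    push_cast
    rw [hw]; field_simp
  have hd : 0 < degWeight h := Real.rpow_pos_of_pos hp _
  have e2 : 1 / degWeight h ≤ degWeight h * w := by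
    rw [div_le_iff₀ hd, hw]
    have : (h : ℝ) ≤ degWeight h * degWeight h := by
      unfold degWeight
      rw [← Real.rpow_add hp]
      calc (h : ℝ) = (h : ℝ) ^ (1 : ℝ) := (Real.rpow_one _).symm
        _ ≤ _ := Real.rpow_le_rpow_of_exponent_le h1 (by linarith [one_le_two_mul_isoBeta])
    rw [show degWeight h * (h : ℝ)⁻¹ * degWeight h = (degWeight h * degWeight h) / h by ring,
      le_div_iff₀ hp]
    linarith
  have e3 := mul_le_mul_of_nonneg_left (one_add_half_le_rpow (by positivity) hw1) hd.le
  rw [e1]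
  have : 1 / (2 * degWeight h) = 1 / degWeight h / 2 := by rw [div_div, mul_comm]
  rw [this]
  linarith

/-- By AM-GM, c - c²y/2 ≤ 1/(2y). The free c makes the bound linear in y = h^β, so that it can be
averaged; the condition c ≤ 1 is the case h = 0. -/
theorem degWeight_increment {c : ℝ} (h1 : c ≤ 1) (h : ℕ) :
    degWeight h + (c - c ^ 2 / 2 * degWeight h) ≤ degWeight (h + 1) := by
  rcases Nat.eq_zero_or_pos h with rfl | hh
  · simp [degWeight_zero, degWeight_one, h1]
  · have := degWeight_succ_ge hh
    have hd : 1 ≤ degWeight h := by simpa [degWeight_one] using degWeight_mono hh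
    have : c - c ^ 2 / 2 * degWeight h ≤ 1 / (2 * degWeight h) := by
      rw [le_div_iff₀ (by positivity)]
      nlinarith [sq_nonneg (c * degWeight h - 1)]
    linarith

/-- The tangent line at `1`, slightly tilted, lies strictly above `h ^ β` off `h = 1`. -/
theorem degWeight_tangent_one {h : ℕ} (hh : h ≠ 1) :
    (1 + degWeight h) / 120 ≤ 1 + 3 / 4 * ((h : ℝ) - 1) - degWeight h := by
  rcases Nat.eq_zero_or_pos h with rfl | hp
  · norm_num [degWeight_zero]
  · have h2 : (2 : ℝ) ≤ h := by exact_mod_cast (by omega : 2 ≤ h)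
    -- Bernoulli gives slope β ≤ 3/5; the excess 3/4 - 3/5 pays for the left side.
    have := rpow_one_add_le_one_add_mul_self (s := (h : ℝ) - 1) (by linarith)
      isoBeta_pos.le (by linarith [isoBeta_le])
    rw [add_sub_cancel] at this
    have h3 : degWeight h ≤ 1 + isoBeta * ((h : ℝ) - 1) := this
    nlinarith [isoBeta_le]

/-- The tangent line at `2`, slightly tilted, lies strictly above `h ^ β` off `h = 2`. -/
theorem degWeight_tangent_two {h : ℕ} (hh : h ≠ 2) :
    (1 + degWeight h) / 120 ≤ 3 / 2 + 19 / 40 * ((h : ℝ) - 2) - degWeight h := by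
  rcases Nat.lt_or_ge h 2 with hp | hp
  · interval_cases h
    · norm_num [degWeight_zero]
    · norm_num [degWeight_one]
  · have h2 : (3 : ℝ) ≤ h := by exact_mod_cast (by omega : 3 ≤ h)
    -- Bernoulli at 2 gives slope at most 9/20 < 19/40; the point h = 1 requires a slope below 1/2.
    have := rpow_one_add_le_one_add_mul_self (s := ((h : ℝ) - 2) / 2) (by linarith)
      isoBeta_pos.le (by linarith [isoBeta_le])
    have h3 : degWeight h ≤ 3 / 2 * (1 + isoBeta * (((h : ℝ) - 2) / 2)) := by
      have e : degWeight h = 3 / 2 * (1 + ((h : ℝ) - 2) / 2) ^ isoBeta := by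
        unfold degWeight
        rw [← two_rpow_isoBeta, ← Real.mul_rpow (by norm_num) (by linarith)]
        congr 1; ring
      rw [e]
      linarith
    nlinarith [isoBeta_le]

/-! ### Averages, flips and slices -/

/-- The average of a function over the cube. -/
noncomputable def cubeAvg {n : ℕ} (f : Cube n → ℝ) : ℝ := (∑ x, f x) / 2 ^ n

theorem cubeAvg_mono {n : ℕ} {f g : Cube n → ℝ} (h : ∀ x, f x ≤ g x) : cubeAvg f ≤ cubeAvg g :=
  div_le_div_of_nonneg_right (Finset.sum_le_sum fun x _ => h x) (by positivity)

theorem cubeAvg_nonneg {n : ℕ} {f : Cube n → ℝ} (h : ∀ x, 0 ≤ f x) : 0 ≤ cubeAvg f :=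
  div_nonneg (Finset.sum_nonneg fun x _ => h x) (by positivity)

theorem cubeAvg_add {n : ℕ} (f g : Cube n → ℝ) :
    cubeAvg (fun x => f x + g x) = cubeAvg f + cubeAvg g := by
  simp [cubeAvg, Finset.sum_add_distrib, add_div]

theorem cubeAvg_sub {n : ℕ} (f g : Cube n → ℝ) :
    cubeAvg (fun x => f x - g x) = cubeAvg f - cubeAvg g := by
  simp [cubeAvg, Finset.sum_sub_distrib, sub_div]

theorem cubeAvg_const_mul {n : ℕ} (c : ℝ) (f : Cube n → ℝ) :
    cubeAvg (fun x => c * f x) = c * cubeAvg f := by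
  simp [cubeAvg, ← Finset.mul_sum, mul_div_assoc]

theorem cubeAvg_mul_const {n : ℕ} (c : ℝ) (f : Cube n → ℝ) :
    cubeAvg (fun x => f x * c) = cubeAvg f * c := by
  simp only [mul_comm _ c, cubeAvg_const_mul]

theorem cubeAvg_const {n : ℕ} (c : ℝ) : cubeAvg (fun _ : Cube n => c) = c := by
  simp [cubeAvg]

theorem cubeAvg_sum {n : ℕ} {ι : Type*} (s : Finset ι) (f : ι → Cube n → ℝ) :
    cubeAvg (fun x => ∑ i ∈ s, f i x) = ∑ i ∈ s, cubeAvg (f i) := by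
  simp only [cubeAvg, Finset.sum_div]
  rw [Finset.sum_comm]

theorem cubeAvg_equiv {n : ℕ} (e : Cube n ≃ Cube n) (f : Cube n → ℝ) :
    cubeAvg (fun x => f (e x)) = cubeAvg f := by
  simp only [cubeAvg, Equiv.sum_comp e f]

theorem cubeAvg_comm {n m : ℕ} (f : Cube n → Cube m → ℝ) :
    cubeAvg (fun x => cubeAvg fun y => f x y) = cubeAvg fun y => cubeAvg fun x => f x y := by
  simp only [cubeAvg, ← Finset.sum_div]
  rw [Finset.sum_comm, div_div, div_div, mul_comm]

/-- Insertion of the value `b` at the coordinate `i`. -/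
def insCoord {n : ℕ} (i : Fin (n + 1)) (b : Bool) (x : Cube n) : Cube (n + 1) :=
  i.insertNth (α := fun _ => Bool) b x

theorem insCoord_same {n : ℕ} (i : Fin (n + 1)) (b : Bool) (x : Cube n) :
    insCoord i b x i = b := by simp [insCoord]

theorem cubeAvg_succ {n : ℕ} (i : Fin (n + 1)) (f : Cube (n + 1) → ℝ) :
    cubeAvg f = (cubeAvg (fun x => f (insCoord i false x)) +
      cubeAvg (fun x => f (insCoord i true x))) / 2 := by
  have : ∑ x, f x = ∑ p : Bool × Cube n, f (insCoord i p.1 p.2) :=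
    (Equiv.sum_comp (Fin.insertNthEquiv (fun _ => Bool) i) f).symm
  simp only [cubeAvg, this, Fintype.sum_prod_type, Fintype.sum_bool]
  rw [pow_succ]
  field_simp
  ring

theorem flipCoord_insCoord_same {n : ℕ} (i : Fin (n + 1)) (b : Bool) (x : Cube n) :
    flipCoord (insCoord i b x) i = insCoord i (!b) x := by
  funext j
  refine Fin.succAboveCases i ?_ (fun j => ?_) j
  · simp [flipCoord, insCoord]
  · simp [flipCoord, insCoord]

theorem flipCoord_insCoord_succAbove {n : ℕ} (i : Fin (n + 1)) (b : Bool) (x : Cube n)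
    (j : Fin n) :
    flipCoord (insCoord i b x) (i.succAbove j) = insCoord i b (flipCoord x j) := by
  funext l
  refine Fin.succAboveCases i ?_ (fun l => ?_) l
  · simp [flipCoord, insCoord, (Fin.succAbove_ne i j).symm]
  · simp [flipCoord, insCoord, Function.update_apply]

theorem flipCoord_flipCoord {n : ℕ} (x : Cube n) (i : Fin n) :
    flipCoord (flipCoord x i) i = x := by
  simp [flipCoord]

/-- Flipping a coordinate, as a permutation of the cube. -/
def flipEquiv {n : ℕ} (i : Fin n) : Cube n ≃ Cube n where
  toFun x := flipCoord x i
  invFun x := flipCoord x i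
  left_inv x := flipCoord_flipCoord x i
  right_inv x := flipCoord_flipCoord x i

/-- The slice of `A` at the value `b` of the coordinate `i`. -/
def cubeSlice {n : ℕ} (i : Fin (n + 1)) (b : Bool) (A : Finset (Cube (n + 1))) :
    Finset (Cube n) := Finset.univ.filter fun x => insCoord i b x ∈ A

theorem mem_cubeSlice {n : ℕ} {i : Fin (n + 1)} {b : Bool} {A : Finset (Cube (n + 1))}
    {x : Cube n} : x ∈ cubeSlice i b A ↔ insCoord i b x ∈ A := by simp [cubeSlice]

/-- The number of neighbours of `x` outside `A`. -/
def outDegree {n : ℕ} (A : Finset (Cube n)) (x : Cube n) : ℕ :=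
  ∑ i, if flipCoord x i ∈ A then 0 else 1

theorem outDegree_insCoord {n : ℕ} (A : Finset (Cube (n + 1))) (i : Fin (n + 1)) (b : Bool)
    (x : Cube n) : outDegree A (insCoord i b x) =
      outDegree (cubeSlice i b A) x + if x ∈ cubeSlice i (!b) A then 0 else 1 := by
  unfold outDegree
  rw [Fin.sum_univ_succAbove _ i, add_comm]
  simp only [flipCoord_insCoord_same, flipCoord_insCoord_succAbove, mem_cubeSlice]

theorem cubeMeasure_eq_avg {n : ℕ} (A : Finset (Cube n)) :
    cubeMeasure A = cubeAvg fun x => if x ∈ A then 1 else 0 := by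
  simp [cubeMeasure, cubeAvg]

theorem cubeMeasure_succ {n : ℕ} (i : Fin (n + 1)) (A : Finset (Cube (n + 1))) :
    cubeMeasure A =
      (cubeMeasure (cubeSlice i false A) + cubeMeasure (cubeSlice i true A)) / 2 := by
  simp only [cubeMeasure_eq_avg, mem_cubeSlice]
  exact cubeAvg_succ i _

theorem cubeMeasure_nonneg {n : ℕ} (A : Finset (Cube n)) : 0 ≤ cubeMeasure A := by
  unfold cubeMeasure; positivity

theorem cubeMeasure_le_one {n : ℕ} (A : Finset (Cube n)) : cubeMeasure A ≤ 1 := by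
  rw [cubeMeasure_eq_avg]
  calc _ ≤ cubeAvg fun _ : Cube n => (1 : ℝ) :=
        cubeAvg_mono fun x => by split_ifs <;> norm_num
    _ = 1 := cubeAvg_const 1

/-! ### The isoperimetric inequality -/

/-- The functional `∫ h_A ^ β dμ`. -/
noncomputable def isoFunctional {n : ℕ} (A : Finset (Cube n)) : ℝ :=
  cubeAvg fun x => if x ∈ A then degWeight (outDegree A x) else 0

theorem isoFunctional_nonneg {n : ℕ} (A : Finset (Cube n)) : 0 ≤ isoFunctional A :=
  cubeAvg_nonneg fun x => by split_ifs <;> simp [degWeight_nonneg]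

/-- For opposite slices P and R, the points of P \ R gain an outer neighbour, and they have measure
at least μ(P) - μ(R). -/
theorem avg_degWeight_add_ge {n : ℕ} (P R : Finset (Cube n)) {c : ℝ} (h0 : 0 ≤ c) (h1 : c ≤ 1) :
    isoFunctional P + c * (cubeMeasure P - cubeMeasure R) - c ^ 2 / 2 * isoFunctional P ≤
      cubeAvg fun x => if x ∈ P then
        degWeight (outDegree P x + if x ∈ R then 0 else 1) else 0 := by
  simp only [isoFunctional, cubeMeasure_eq_avg]
  rw [← cubeAvg_sub, ← cubeAvg_const_mul, ← cubeAvg_const_mul, ← cubeAvg_add, ← cubeAvg_sub]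
  refine cubeAvg_mono fun x => ?_
  have := degWeight_increment h1 (outDegree P x)
  have := mul_nonneg (sq_nonneg c) (degWeight_nonneg (outDegree P x))
  split_ifs <;> simp <;> linarith

theorem isoFunctional_succ {n : ℕ} (i : Fin (n + 1)) (A : Finset (Cube (n + 1))) :
    2 * isoFunctional A =
      (cubeAvg fun x => if x ∈ cubeSlice i false A then
        degWeight (outDegree (cubeSlice i false A) x +
          if x ∈ cubeSlice i true A then 0 else 1) else 0) +
      cubeAvg fun x => if x ∈ cubeSlice i true A then
        degWeight (outDegree (cubeSlice i true A) x +
          if x ∈ cubeSlice i false A then 0 else 1) else 0 := by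
  unfold isoFunctional
  rw [cubeAvg_succ i]
  simp only [outDegree_insCoord, mem_cubeSlice, Bool.not_true, Bool.not_false]
  ring

/-- The isoperimetric inequality `∫ h_A ^ β dμ ≥ 2 μ(A) (1 - μ(A))`. -/
theorem isoperimetric : ∀ {n : ℕ} (A : Finset (Cube n)),
    2 * cubeMeasure A * (1 - cubeMeasure A) ≤ isoFunctional A := by
  intro n
  induction n with
  | zero =>
    intro A
    have h : cubeMeasure A = 0 ∨ cubeMeasure A = 1 := by
      have hc : A.card ≤ 1 := by simpa using Finset.card_le_univ A
      unfold cubeMeasure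
      interval_cases A.card <;> simp
    have := isoFunctional_nonneg A
    rcases h with h | h <;> rw [h] <;> linarith
  | succ n ih =>
    intro A
    have key : ∀ P R : Finset (Cube n), cubeMeasure R ≤ cubeMeasure P →
        4 * ((cubeMeasure P + cubeMeasure R) / 2) * (1 - (cubeMeasure P + cubeMeasure R) / 2) ≤
          (cubeAvg fun x => if x ∈ P then
            degWeight (outDegree P x + if x ∈ R then 0 else 1) else 0) +
          cubeAvg fun x => if x ∈ R then
            degWeight (outDegree R x + if x ∈ P then 0 else 1) else 0 := by
      intro P R hPR
      have hR := avg_degWeight_add_ge R P (c := 0) le_rfl zero_le_one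
      have iP := ih P
      have iR := ih R
      have := cubeMeasure_nonneg R
      have := cubeMeasure_le_one P
      set a := cubeMeasure P
      set b := cubeMeasure R
      rcases le_total (a - b) (1 / 2) with ht | ht
      -- This c leaves exactly the slack (a - b)²(1 - 2a)². Beyond a - b = 1/2 it would exceed 1;
      -- there c = 1 leaves t(1 - t) - a(1 - a) ≥ 0 with t = a - b, as a ≥ t ≥ 1/2.
      · have hP := avg_degWeight_add_ge P R (c := 2 * (a - b)) (by linarith) (by linarith)
        have h2 : 0 ≤ 1 - (2 * (a - b)) ^ 2 / 2 := by nlinarith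
        have h3 := mul_le_mul_of_nonneg_left iP h2
        have h4 : 0 ≤ (a - b) ^ 2 * (1 - 2 * a) ^ 2 := by positivity
        nlinarith
      · have hP := avg_degWeight_add_ge P R (c := 1) zero_le_one le_rfl
        nlinarith
    have hs := isoFunctional_succ 0 A
    rw [cubeMeasure_succ 0 A]
    rcases le_total (cubeMeasure (cubeSlice 0 true A)) (cubeMeasure (cubeSlice 0 false A)) with h | h
    · have := key _ _ h
      linarith
    · have := key _ _ h
      rw [add_comm (cubeMeasure (cubeSlice 0 false A))]
      linarith

/-! ### Conditional energy of boundary edges -/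

/-- The indicator that `{x, x^i}` is a boundary edge of `A` with inner endpoint in `G ⊆ A`. -/
noncomputable def edgeInd {n : ℕ} (A G : Finset (Cube n)) (i : Fin n) (x : Cube n) : ℝ :=
  (if x ∈ G ∧ flipCoord x i ∉ A then 1 else 0) + (if flipCoord x i ∈ G ∧ x ∉ A then 1 else 0)

theorem edgeInd_nonneg {n : ℕ} (A G : Finset (Cube n)) (i : Fin n) (x : Cube n) :
    0 ≤ edgeInd A G i x := by
  unfold edgeInd; split_ifs <;> norm_num

theorem edgeInd_zero_or_one {n : ℕ} {A G : Finset (Cube n)} (hG : G ⊆ A) (i : Fin n)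
    (x : Cube n) : edgeInd A G i x = 0 ∨ edgeInd A G i x = 1 := by
  unfold edgeInd
  by_cases h1 : x ∈ G ∧ flipCoord x i ∉ A
  · have : x ∈ A := hG h1.1
    simp [h1, this]
  · simp only [h1, if_false, zero_add]
    split_ifs <;> simp

theorem edgeInd_flipCoord {n : ℕ} (A G : Finset (Cube n)) (i : Fin n) (x : Cube n) :
    edgeInd A G i (flipCoord x i) = edgeInd A G i x := by
  unfold edgeInd
  rw [flipCoord_flipCoord, add_comm]

theorem avg_edgeInd {n : ℕ} (A G : Finset (Cube n)) (i : Fin n) :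
    cubeAvg (edgeInd A G i) =
      2 * cubeAvg fun x => if x ∈ G ∧ flipCoord x i ∉ A then 1 else 0 := by
  have := cubeAvg_equiv (flipEquiv i) fun x => if x ∈ G ∧ flipCoord x i ∉ A then (1 : ℝ) else 0
  simp only [flipEquiv, Equiv.coe_fn_mk, flipCoord_flipCoord] at this
  unfold edgeInd
  rw [cubeAvg_add, this]
  ring

theorem sum_avg_edgeInd {n : ℕ} (A G : Finset (Cube n)) :
    ∑ i, cubeAvg (edgeInd A G i) =
      2 * cubeAvg fun x => if x ∈ G then (outDegree A x : ℝ) else 0 := by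
  simp only [avg_edgeInd]
  rw [← Finset.mul_sum, ← cubeAvg_sum]
  congr 2
  funext x
  by_cases hx : x ∈ G
  · simp only [hx, true_and, if_true, outDegree]
    push_cast
    exact Finset.sum_congr rfl fun i _ => by split_ifs <;> simp
  · simp [hx]

/-- The point with the coordinates of `x` below `i` and those of `z` from `i` on. -/
def mixLt {n : ℕ} (i : Fin n) (x z : Cube n) : Cube n := fun j => if j < i then x j else z j

/-- The sum over `i` of the second moments of the edge indicators in direction `i`,
conditioned on the coordinates below `i`. -/
noncomputable def condEnergy {n : ℕ} (A G : Finset (Cube n)) : ℝ :=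
  ∑ i, cubeAvg fun x => cubeAvg fun z => edgeInd A G i x * edgeInd A G i (mixLt i x z)

theorem condEnergy_nonneg {n : ℕ} (A G : Finset (Cube n)) : 0 ≤ condEnergy A G :=
  Finset.sum_nonneg fun _ _ => cubeAvg_nonneg fun _ => cubeAvg_nonneg fun _ =>
    mul_nonneg (edgeInd_nonneg ..) (edgeInd_nonneg ..)

theorem edgeInd_insCoord_succ {n : ℕ} (A G : Finset (Cube (n + 1))) (b : Bool) (j : Fin n)
    (x : Cube n) : edgeInd A G j.succ (insCoord 0 b x) =
      edgeInd (cubeSlice 0 b A) (cubeSlice 0 b G) j x := by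
  have := flipCoord_insCoord_succAbove 0 b x j
  rw [Fin.succAbove_zero] at this
  simp only [edgeInd, this, mem_cubeSlice]

theorem insCoord_zero {n : ℕ} (b : Bool) (x : Cube n) :
    insCoord 0 b x = Fin.cons (α := fun _ => Bool) b x := by
  simp only [insCoord, Fin.insertNth_zero]
  rfl

theorem mixLt_zero {n : ℕ} (x z : Cube (n + 1)) : mixLt 0 x z = z := by
  funext j; simp [mixLt]

theorem mixLt_succ {n : ℕ} (b c : Bool) (j : Fin n) (x z : Cube n) :
    mixLt j.succ (insCoord 0 b x) (insCoord 0 c z) = insCoord 0 b (mixLt j x z) := by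
  funext l
  simp only [insCoord_zero, mixLt]
  refine Fin.cases ?_ (fun l => ?_) l <;> simp [mixLt]

/-- No coordinate precedes 0, so its term is a squared mean. In later directions x and the mixed
point share the first coordinate, so the energy splits over the slices. -/
theorem condEnergy_succ {n : ℕ} (A G : Finset (Cube (n + 1))) :
    condEnergy A G = cubeAvg (edgeInd A G 0) ^ 2 +
      (condEnergy (cubeSlice 0 false A) (cubeSlice 0 false G) +
        condEnergy (cubeSlice 0 true A) (cubeSlice 0 true G)) / 2 := by
  unfold condEnergy
  rw [Fin.sum_univ_succ]
  congr 1
  · simp only [mixLt_zero, cubeAvg_const_mul, cubeAvg_mul_const]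
    ring
  · rw [← Finset.sum_add_distrib, Finset.sum_div]
    refine Finset.sum_congr rfl fun j _ => ?_
    have h : ∀ (b : Bool) (x : Cube n),
        (cubeAvg fun z => edgeInd (cubeSlice 0 b A) (cubeSlice 0 b G) j x *
          edgeInd A G j.succ (mixLt j.succ (insCoord 0 b x) z)) =
        cubeAvg fun z => edgeInd (cubeSlice 0 b A) (cubeSlice 0 b G) j x *
          edgeInd (cubeSlice 0 b A) (cubeSlice 0 b G) j (mixLt j x z) := fun b x => by
      rw [cubeAvg_succ 0]
      simp only [mixLt_succ, edgeInd_insCoord_succ, add_self_div_two]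
    rw [cubeAvg_succ 0]
    simp only [edgeInd_insCoord_succ, h]

/-- The part of `∫ h_A ^ β dμ` coming from `A \ G`. -/
noncomputable def isoRest {n : ℕ} (A G : Finset (Cube n)) : ℝ :=
  cubeAvg fun x => if x ∈ A ∧ x ∉ G then degWeight (outDegree A x) else 0

theorem isoRest_nonneg {n : ℕ} (A G : Finset (Cube n)) : 0 ≤ isoRest A G :=
  cubeAvg_nonneg fun x => by split_ifs <;> simp [degWeight_nonneg]

theorem isoRest_succ_ge {n : ℕ} (A G : Finset (Cube (n + 1))) {c : ℝ} (h1 : c ≤ 1) :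
    (1 - c ^ 2 / 2) * (isoRest (cubeSlice 0 false A) (cubeSlice 0 false G) +
        isoRest (cubeSlice 0 true A) (cubeSlice 0 true G)) +
      c * cubeAvg (edgeInd A (A \ G) 0) ≤ 2 * isoRest A G := by
  have key : ∀ b : Bool, (1 - c ^ 2 / 2) * isoRest (cubeSlice 0 b A) (cubeSlice 0 b G) +
      c * (cubeAvg fun x => if insCoord 0 b x ∈ A \ G ∧ insCoord 0 (!b) x ∉ A then 1 else 0) ≤
      cubeAvg fun x => if insCoord 0 b x ∈ A ∧ insCoord 0 b x ∉ G then
        degWeight (outDegree A (insCoord 0 b x)) else 0 := by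
    intro b
    unfold isoRest
    rw [← cubeAvg_const_mul, ← cubeAvg_const_mul, ← cubeAvg_add]
    refine cubeAvg_mono fun x => ?_
    have := degWeight_increment h1 (outDegree (cubeSlice 0 b A) x)
    have := mul_nonneg (sq_nonneg c) (degWeight_nonneg (outDegree (cubeSlice 0 b A) x))
    simp only [outDegree_insCoord, mem_cubeSlice, Finset.mem_sdiff]
    by_cases h : insCoord 0 b x ∈ A ∧ insCoord 0 b x ∉ G
    · by_cases h' : insCoord 0 (!b) x ∈ A <;> simp [h, h'] <;> linarith
    · simp [h]
  have kf := key false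
  have kt := key true
  have e1 : 2 * isoRest A G = _ := congrArg (2 * ·) (cubeAvg_succ 0 _)
  rw [avg_edgeInd, cubeAvg_succ 0]
  simp only [flipCoord_insCoord_same]
  simp only [Bool.not_true, Bool.not_false] at *
  linarith

/-- Where the slices differ there is a boundary edge, with inner endpoint in G or in A \ G. -/
theorem abs_slice_sub_le {n : ℕ} {A G : Finset (Cube (n + 1))} (hG : G ⊆ A) :
    |cubeMeasure (cubeSlice 0 false A) - cubeMeasure (cubeSlice 0 true A)| ≤
      cubeAvg (edgeInd A G 0) + cubeAvg (edgeInd A (A \ G) 0) := by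
  rw [← cubeAvg_add, cubeAvg_succ 0]
  simp only [cubeMeasure_eq_avg, mem_cubeSlice, edgeInd, flipCoord_insCoord_same,
    Bool.not_true, Bool.not_false]
  rw [← cubeAvg_sub, ← cubeAvg_add, abs_le, div_eq_inv_mul, ← cubeAvg_const_mul, ← neg_one_mul,
    ← cubeAvg_const_mul]
  constructor <;>
  · refine cubeAvg_mono fun x => ?_
    have h1 := @hG (insCoord 0 false x)
    have h2 := @hG (insCoord 0 true x)
    by_cases a1 : insCoord 0 false x ∈ A <;> by_cases a2 : insCoord 0 true x ∈ A <;>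
      by_cases g1 : insCoord 0 false x ∈ G <;> by_cases g2 : insCoord 0 true x ∈ G <;>
      simp_all <;> norm_num

theorem avg_edgeInd_le_one {n : ℕ} {A G : Finset (Cube n)} (hG : G ⊆ A) (i : Fin n) :
    cubeAvg (edgeInd A G i) ≤ 1 :=
  (cubeAvg_mono fun x => by rcases edgeInd_zero_or_one hG i x with h | h <;> rw [h]; norm_num
    ).trans (cubeAvg_const 1).le

/-- A Poincaré type inequality: the variance of `A` is controlled by the conditional energy of
the edges at `G` and the isoperimetric functional of the rest of `A`. -/
theorem variance_le_condEnergy : ∀ {n : ℕ} {A G : Finset (Cube n)}, G ⊆ A →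
    4 * cubeMeasure A * (1 - cubeMeasure A) ≤ 21 / 20 * condEnergy A G + 84 * isoRest A G := by
  intro n
  induction n with
  | zero =>
    intro A G _
    have h : cubeMeasure A = 0 ∨ cubeMeasure A = 1 := by
      have hc : A.card ≤ 1 := by simpa using Finset.card_le_univ A
      unfold cubeMeasure
      interval_cases A.card <;> simp
    have := isoRest_nonneg A G
    have := condEnergy_nonneg A G
    rcases h with h | h <;> rw [h] <;> linarith
  | succ n ih =>
    intro A G hG
    have hS := condEnergy_nonneg A G
    by_cases hbig : 1 ≤ 84 * isoRest A G
    · nlinarith [sq_nonneg (2 * cubeMeasure A - 1)]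
    · push Not at hbig
      have hsub : ∀ b, cubeSlice 0 b G ⊆ cubeSlice 0 b A := fun b x hx =>
        mem_cubeSlice.2 (hG (mem_cubeSlice.1 hx))
      have h0 := ih (hsub false)
      have h1 := ih (hsub true)
      have ht := abs_slice_sub_le hG
      have he : 0 ≤ cubeAvg (edgeInd A (A \ G) 0) := cubeAvg_nonneg fun x => edgeInd_nonneg ..
      have he1 : cubeAvg (edgeInd A (A \ G) 0) ≤ 1 := avg_edgeInd_le_one Finset.sdiff_subset 0
      have hd : 0 ≤ cubeAvg (edgeInd A G 0) := cubeAvg_nonneg fun x => edgeInd_nonneg ..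
      -- Taking c = e gains e²; c = 0 on the next line bounds r.
      have hr := isoRest_succ_ge A G he1
      have hr0 := isoRest_succ_ge A G zero_le_one
      have n0 := isoRest_nonneg (cubeSlice 0 false A) (cubeSlice 0 false G)
      have n1 := isoRest_nonneg (cubeSlice 0 true A) (cubeSlice 0 true G)
      rw [condEnergy_succ, cubeMeasure_succ 0 A]
      set e := cubeAvg (edgeInd A (A \ G) 0)
      set d := cubeAvg (edgeInd A G 0)
      set a := cubeMeasure (cubeSlice 0 false A)
      set b := cubeMeasure (cubeSlice 0 true A)
      set r := isoRest (cubeSlice 0 false A) (cubeSlice 0 false G) +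
        isoRest (cubeSlice 0 true A) (cubeSlice 0 true G) with hr_def
      have t2 : (a - b) ^ 2 ≤ (d + e) ^ 2 := sq_le_sq' (by linarith [(abs_le.1 ht).1])
        (abs_le.1 ht).2
      have hr2 : r ≤ 1 := by linarith
      have hr3 : r + e ^ 2 / 2 ≤ 2 * isoRest A G := by
        nlinarith [mul_nonneg (sq_nonneg e) (sub_nonneg.2 hr2)]
      -- The variance is the mean of the slice variances plus (a - b)², and (d + e)² ≤ 21/20 d² + 21
      -- e². The term 21 e² is absorbed by 84 · e²/4 from `hr3`.
      nlinarith [sq_nonneg (d - 20 * e)]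

/-! ### Reversing the order; an influential direction -/

/-- Reversal of the coordinates. -/
def revEquiv (n : ℕ) : Cube n ≃ Cube n where
  toFun x := fun j => x j.rev
  invFun x := fun j => x j.rev
  left_inv x := by simp
  right_inv x := by simp

theorem revEquiv_apply {n : ℕ} (x : Cube n) (j : Fin n) : revEquiv n x j = x j.rev := rfl

/-- The set `A` with its coordinates reversed. -/
def revSet {n : ℕ} (A : Finset (Cube n)) : Finset (Cube n) :=
  Finset.univ.filter fun x => revEquiv n x ∈ A

theorem mem_revSet {n : ℕ} {A : Finset (Cube n)} {x : Cube n} :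
    x ∈ revSet A ↔ revEquiv n x ∈ A := by simp [revSet]

theorem revEquiv_flipCoord {n : ℕ} (x : Cube n) (i : Fin n) :
    revEquiv n (flipCoord x i) = flipCoord (revEquiv n x) i.rev := by
  funext j
  simp [revEquiv_apply, flipCoord, Function.update_apply, Fin.rev_eq_iff]

theorem edgeInd_revSet {n : ℕ} (A G : Finset (Cube n)) (i : Fin n) (x : Cube n) :
    edgeInd (revSet A) (revSet G) i x = edgeInd A G i.rev (revEquiv n x) := by
  simp only [edgeInd, mem_revSet, revEquiv_flipCoord]

theorem outDegree_revSet {n : ℕ} (A : Finset (Cube n)) (x : Cube n) :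
    outDegree (revSet A) x = outDegree A (revEquiv n x) := by
  simp only [outDegree, mem_revSet, revEquiv_flipCoord]
  exact Equiv.sum_comp Fin.revPerm fun i => if flipCoord (revEquiv n x) i ∈ A then 0 else 1

theorem cubeMeasure_revSet {n : ℕ} (A : Finset (Cube n)) :
    cubeMeasure (revSet A) = cubeMeasure A := by
  simp only [cubeMeasure_eq_avg, mem_revSet]
  exact cubeAvg_equiv (revEquiv n) fun x => if x ∈ A then 1 else 0

theorem isoRest_revSet {n : ℕ} (A G : Finset (Cube n)) :
    isoRest (revSet A) (revSet G) = isoRest A G := by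
  simp only [isoRest, mem_revSet, outDegree_revSet]
  exact cubeAvg_equiv (revEquiv n) fun x =>
    if x ∈ A ∧ x ∉ G then degWeight (outDegree A x) else 0

/-- The point with the coordinates of `x` above `i` and those of `z` up to `i`. -/
def mixGt {n : ℕ} (i : Fin n) (x z : Cube n) : Cube n := fun j => if i < j then x j else z j

theorem revEquiv_mixLt {n : ℕ} (i : Fin n) (x z : Cube n) :
    revEquiv n (mixLt i.rev x z) = mixGt i (revEquiv n x) (revEquiv n z) := by
  funext j
  simp [revEquiv_apply, mixLt, mixGt, Fin.rev_lt_rev]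

theorem condEnergy_revSet {n : ℕ} (A G : Finset (Cube n)) :
    condEnergy (revSet A) (revSet G) =
      ∑ i, cubeAvg fun x => cubeAvg fun z => edgeInd A G i x * edgeInd A G i (mixGt i x z) := by
  unfold condEnergy
  rw [← Equiv.sum_comp Fin.revPerm]
  refine Finset.sum_congr rfl fun i _ => ?_
  simp only [edgeInd_revSet, Fin.revPerm_apply, Fin.rev_rev, revEquiv_mixLt]
  rw [cubeAvg_equiv (revEquiv n) fun x => cubeAvg fun z =>
    edgeInd A G i x * edgeInd A G i (mixGt i x (revEquiv n z))]
  congr 1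
  funext x
  exact cubeAvg_equiv (revEquiv n) fun z => edgeInd A G i x * edgeInd A G i (mixGt i x z)

/-- The two mixed points differ at most in coordinate i, which `edgeInd` in direction i does not
see. -/
theorem edgeInd_mixGt {n : ℕ} (A G : Finset (Cube n)) (i : Fin n) (x z : Cube n) :
    edgeInd A G i (mixGt i z x) = edgeInd A G i (mixLt i x z) := by
  by_cases h : x i = z i
  · congr 1
    funext j
    rcases lt_trichotomy i j with hj | rfl | hj
    · simp [mixGt, mixLt, hj, hj.le]
    · simp [mixGt, mixLt, h]
    · simp [mixGt, mixLt, hj, hj.le]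
  · rw [← edgeInd_flipCoord]
    congr 1
    funext j
    rcases lt_trichotomy i j with hj | rfl | hj
    · simp [mixGt, mixLt, flipCoord, hj, hj.le, hj.ne']
    · simp only [flipCoord, mixGt, mixLt, Function.update_self, lt_irrefl, if_false]
      cases hx : x i <;> cases hz : z i <;> simp_all
    · simp [mixGt, mixLt, flipCoord, hj, hj.le, hj.ne]

/-- Exchanging the coordinates of x and z from i on is an involution of the pairs. -/
theorem cubeAvg_mixLt {n : ℕ} (i : Fin n) (f : Cube n → ℝ) :
    (cubeAvg fun x => cubeAvg fun z => f (mixLt i x z)) = cubeAvg f := by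
  let e : Cube n × Cube n → Cube n × Cube n := fun p => (mixLt i p.1 p.2, mixLt i p.2 p.1)
  have he : Function.Involutive e := fun p => by
    ext j <;> by_cases h : j < i <;> simp [e, mixLt, h]
  have h := Equiv.sum_comp he.toPerm fun p => f p.1
  simp only [Function.Involutive.coe_toPerm, Fintype.sum_prod_type, e] at h
  have h' := congrArg (fun t : ℝ => t / 2 ^ n / 2 ^ n) h
  simp only [cubeAvg, ← Finset.sum_div]
  refine h'.trans ?_
  simp [← Finset.mul_sum]

/-- Resampling first the coordinates below `i` and then the others. -/
theorem sum_sq_avg_edgeInd_ge {n : ℕ} {A G : Finset (Cube n)} (hG : G ⊆ A) :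
    condEnergy A G + condEnergy (revSet A) (revSet G) - ∑ i, cubeAvg (edgeInd A G i) ≤
      ∑ i, cubeAvg (edgeInd A G i) ^ 2 := by
  rw [condEnergy_revSet]
  unfold condEnergy
  rw [← Finset.sum_add_distrib, ← Finset.sum_sub_distrib]
  refine Finset.sum_le_sum fun i _ => ?_
  set g := edgeInd A G i with hg
  have e1 : cubeAvg g ^ 2 = cubeAvg fun x => cubeAvg fun z => g x * g z := by
    simp only [cubeAvg_const_mul, cubeAvg_mul_const]
    ring
  have e2 : (cubeAvg fun x => cubeAvg fun z => g x * g (mixGt i x z)) =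
      cubeAvg fun x => cubeAvg fun z => g z * g (mixLt i x z) := by
    rw [cubeAvg_comm]
    simp only [hg, edgeInd_mixGt]
  have e3 : (cubeAvg fun x => cubeAvg fun z => g (mixLt i x z)) = cubeAvg g :=
    cubeAvg_mixLt i g
  rw [e1, e2, ← e3, ← cubeAvg_add, ← cubeAvg_sub]
  refine cubeAvg_mono fun x => ?_
  rw [← cubeAvg_add, ← cubeAvg_sub]
  refine cubeAvg_mono fun z => ?_
  -- For p, q, u in {0,1}, u(p + q - 1) ≤ pq; here u is the value at the mixed point.
  rcases edgeInd_zero_or_one hG i x with h1 | h1 <;>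
  rcases edgeInd_zero_or_one hG i z with h2 | h2 <;>
  rcases edgeInd_zero_or_one hG i (mixLt i x z) with h3 | h3 <;>
  simp only [hg, h1, h2, h3] <;> norm_num

/-- A sum of squares is at most the maximum times the sum. The factor 80/21 is 2 · 2 · 20/21, one 2
coming from the two orders. -/
theorem exists_avg_edgeInd_ge {n : ℕ} {A G : Finset (Cube n)} (hG : G ⊆ A) (hn : 0 < n) :
    ∃ i, 80 / 21 * (2 * cubeMeasure A * (1 - cubeMeasure A)  - 42 * isoRest A G) -
      ∑ i, cubeAvg (edgeInd A G i) ≤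
      cubeAvg (edgeInd A G i) * ∑ i, cubeAvg (edgeInd A G i) := by
  have : Nonempty (Fin n) := ⟨⟨0, hn⟩⟩
  obtain ⟨i, hi⟩ := Finite.exists_max fun i => cubeAvg (edgeInd A G i)
  refine ⟨i, ?_⟩
  have h1 := variance_le_condEnergy hG
  have h2 := variance_le_condEnergy (A := revSet A) (G := revSet G) fun x hx =>
    mem_revSet.2 (hG (mem_revSet.1 hx))
  rw [cubeMeasure_revSet, isoRest_revSet] at h2
  have h3 := sum_sq_avg_edgeInd_ge hG
  have h4 : ∑ i, cubeAvg (edgeInd A G i) ^ 2 ≤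
      cubeAvg (edgeInd A G i) * ∑ i, cubeAvg (edgeInd A G i) := by
    rw [Finset.mul_sum]
    refine Finset.sum_le_sum fun j _ => ?_
    rw [sq]
    exact mul_le_mul_of_nonneg_right (hi j) (cubeAvg_nonneg fun x => edgeInd_nonneg ..)
  linarith

/-! ### Slices of near-subcubes -/

/-- `A` has measure close to `2 ^ (-k)` and almost all its points have exactly `k` neighbours
outside `A`. -/
def NearSubcube {n : ℕ} (k : ℕ) (A : Finset (Cube n)) (η : ℝ) : Prop :=
  |cubeMeasure A - ((2 : ℝ) ^ k)⁻¹| ≤ η ∧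
    (cubeAvg fun x => if x ∈ A ∧ outDegree A x ≠ k then 1 + degWeight (outDegree A x) else 0) ≤ η

/-- The points of `A` with exactly `k` neighbours outside `A`. -/
def exactPart {n : ℕ} (k : ℕ) (A : Finset (Cube n)) : Finset (Cube n) :=
  A.filter fun x => outDegree A x = k

theorem mem_exactPart {n k : ℕ} {A : Finset (Cube n)} {x : Cube n} :
    x ∈ exactPart k A ↔ x ∈ A ∧ outDegree A x = k := by simp [exactPart]

theorem NearSubcube.isoFunctional_le {n k : ℕ} {A : Finset (Cube n)} {η : ℝ}
    (h : NearSubcube k A η) : isoFunctional A ≤ degWeight k * cubeMeasure A + η := by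
  refine le_trans ?_ (add_le_add_right h.2 _)
  rw [cubeMeasure_eq_avg, ← cubeAvg_const_mul, ← cubeAvg_add]
  refine cubeAvg_mono fun x => ?_
  have := degWeight_nonneg k
  by_cases hx : x ∈ A <;> by_cases hk : outDegree A x = k <;> simp [hx, hk]
  linarith

theorem NearSubcube.isoRest_le {n k : ℕ} {A : Finset (Cube n)} {η : ℝ}
    (h : NearSubcube k A η) : isoRest A (exactPart k A) ≤ η := by
  refine le_trans (cubeAvg_mono fun x => ?_) h.2
  have := degWeight_nonneg (outDegree A x)
  by_cases hx : x ∈ A <;> by_cases hk : outDegree A x = k <;> simp [hx, hk, mem_exactPart]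

theorem sum_avg_edgeInd_exactPart_le {n : ℕ} (k : ℕ) (A : Finset (Cube n)) :
    ∑ i, cubeAvg (edgeInd A (exactPart k A) i) ≤ 2 * k * cubeMeasure A := by
  rw [sum_avg_edgeInd, mul_assoc, cubeMeasure_eq_avg, ← cubeAvg_const_mul (k : ℝ)]
  refine mul_le_mul_of_nonneg_left (cubeAvg_mono fun x => ?_) (by norm_num)
  by_cases hx : x ∈ A <;> by_cases hk : outDegree A x = k <;> simp [hx, hk, mem_exactPart]

/-- Slicing forgets the outer neighbour across i: points with exactly k + 1 outer neighbours lose a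
definite amount, and no point gains. -/
theorem isoFunctional_slices_le {n : ℕ} (k : ℕ) (A : Finset (Cube (n + 1))) (i : Fin (n + 1)) :
    isoFunctional (cubeSlice i false A) + isoFunctional (cubeSlice i true A) +
      (degWeight (k + 1) - degWeight k) * cubeAvg (edgeInd A (exactPart (k + 1) A) i) ≤
      2 * isoFunctional A := by
  have key : ∀ b : Bool, isoFunctional (cubeSlice i b A) + (degWeight (k + 1) - degWeight k) *
      (cubeAvg fun x => if insCoord i b x ∈ exactPart (k + 1) A ∧ insCoord i (!b) x ∉ A
        then 1 else 0) ≤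
      cubeAvg fun x => if insCoord i b x ∈ A then
        degWeight (outDegree A (insCoord i b x)) else 0 := by
    intro b
    unfold isoFunctional
    rw [← cubeAvg_const_mul, ← cubeAvg_add]
    refine cubeAvg_mono fun x => ?_
    have := degWeight_mono (Nat.le_succ (outDegree (cubeSlice i b A) x))
    simp only [mem_exactPart, outDegree_insCoord, mem_cubeSlice]
    by_cases h : insCoord i b x ∈ A
    · by_cases h' : insCoord i (!b) x ∈ A
      · simp [h, h']
      · by_cases hk : outDegree (cubeSlice i b A) x = k
        · simp [h, h', hk]
        · simpa [h, h', hk] using this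
    · simp [h]
  have kf := key false
  have kt := key true
  have e1 : 2 * isoFunctional A = _ := congrArg (2 * ·) (cubeAvg_succ i _)
  rw [avg_edgeInd, cubeAvg_succ i]
  simp only [flipCoord_insCoord_same]
  simp only [Bool.not_true, Bool.not_false] at *
  linarith

/-- The left side of `hs` is 2(a + b) - 2(a + b)² + 4ab, and (a - 1/8)(b - 1/8) > 0 would bound ab
from below. -/
theorem slice_small_of_le {a b s : ℝ} (hs : 2 * a * (1 - a) + 2 * b * (1 - b) ≤ s)
    (h : s < 2 * (a + b) - 2 * (a + b) ^ 2 + (a + b) / 2 - 1 / 16) : a ≤ 1 / 8 ∨ b ≤ 1 / 8 := by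
  by_contra! hc
  nlinarith [mul_pos (sub_pos.2 hc.1) (sub_pos.2 hc.2)]

theorem exists_slice_le {n k : ℕ} (hk : k = 1 ∨ k = 2) {A : Finset (Cube (n + 1))} {η : ℝ}
    (h : NearSubcube k A η) (hη : η ≤ 1 / 10000) :
    ∃ i b, cubeMeasure (cubeSlice i b A) ≤ 1 / 8 := by
  obtain ⟨i, hi⟩ := exists_avg_edgeInd_ge (G := exactPart k A) (Finset.filter_subset _ A)
    n.succ_pos
  refine ⟨i, ?_⟩
  suffices cubeMeasure (cubeSlice i false A) ≤ 1 / 8 ∨ cubeMeasure (cubeSlice i true A) ≤ 1 / 8 by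
    rcases this with h | h
    exacts [⟨_, h⟩, ⟨_, h⟩]
  have h1 := h.isoFunctional_le
  have h2 := h.isoRest_le
  have h3 := sum_avg_edgeInd_exactPart_le k A
  have h4 := isoFunctional_slices_le (k - 1) A i
  have p0 := isoperimetric (cubeSlice i false A)
  have p1 := isoperimetric (cubeSlice i true A)
  have hd : 0 ≤ cubeAvg (edgeInd A (exactPart k A) i) := cubeAvg_nonneg fun x => edgeInd_nonneg ..
  have hμ := abs_le.1 h.1
  have e := cubeMeasure_succ i A
  set d := cubeAvg (edgeInd A (exactPart k A) i)
  set D := ∑ i, cubeAvg (edgeInd A (exactPart k A) i)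
  set m := cubeMeasure A
  have hη0 : 0 ≤ η := by linarith
  have hdD := mul_le_mul_of_nonneg_left h3 hd
  refine slice_small_of_le (add_le_add p0 p1) ?_
  have e2 : cubeMeasure (cubeSlice i false A) + cubeMeasure (cubeSlice i true A) = 2 * m := by
    linarith
  rw [e2]
  -- The influence is at least about 80/21 · 1/2 - 1 ≈ 0.90, respectively 80/21 · 3/8 - 1 ≈ 0.43.
  -- The slices then total about 0.14, respectively 0.55, below the thresholds near 7/16 and 11/16.
  rcases hk with rfl | rfl
  · norm_num [degWeight_zero, degWeight_one] at h1 h3 h4 hμ hdD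
    obtain ⟨l1, l2⟩ := hμ
    have hv : 2 * m * (1 - m) ≥ 1 / 2 - 1 / 1000 := by nlinarith
    have hd' : 86 / 100 ≤ d := by nlinarith
    nlinarith
  · norm_num [degWeight_one, degWeight_two] at h1 h3 h4 hμ hdD
    obtain ⟨l1, l2⟩ := hμ
    have hv : 2 * m * (1 - m) ≥ 3 / 8 - 1 / 1000 := by nlinarith
    have hd' : 40 / 100 ≤ d := by nlinarith
    nlinarith

/-- With m the measure of the slice, its functional is at most 3m/2 + 2η, but at least 7m/4 by
isoperimetry once m ≤ 1/8. -/
theorem NearSubcube.slice_le {n k : ℕ} (hk : k = 1 ∨ k = 2) {A : Finset (Cube (n + 1))} {η : ℝ}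
    (h : NearSubcube k A η) {i : Fin (n + 1)} {b : Bool}
    (hb : cubeMeasure (cubeSlice i b A) ≤ 1 / 8) : cubeMeasure (cubeSlice i b A) ≤ 8 * η := by
  have hρ : degWeight k ≤ 3 / 2 := by
    rcases hk with rfl | rfl <;> norm_num [degWeight_one, degWeight_two]
  have h1 : isoFunctional (cubeSlice i b A) ≤ 3 / 2 * cubeMeasure (cubeSlice i b A) + 2 * η := by
    have h2 := h.2
    rw [cubeAvg_succ i] at h2
    have h3 : ∀ c : Bool, 0 ≤ cubeAvg fun x => if insCoord i c x ∈ A ∧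
        outDegree A (insCoord i c x) ≠ k then 1 + degWeight (outDegree A (insCoord i c x)) else 0 :=
      fun c => cubeAvg_nonneg fun x => by
        have := degWeight_nonneg (outDegree A (insCoord i c x))
        split_ifs <;> linarith
    have h4 : (cubeAvg fun x => if insCoord i b x ∈ A ∧ outDegree A (insCoord i b x) ≠ k then
        1 + degWeight (outDegree A (insCoord i b x)) else 0) ≤ 2 * η := by
      have hf := h3 false
      have ht := h3 true
      cases b <;> linarith
    refine le_trans ?_ (add_le_add_right h4 _)
    rw [cubeMeasure_eq_avg, ← cubeAvg_const_mul, ← cubeAvg_add]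
    refine cubeAvg_mono fun x => ?_
    have hm : degWeight (outDegree (cubeSlice i b A) x) ≤ degWeight (outDegree A (insCoord i b x)) :=
      degWeight_mono (by rw [outDegree_insCoord]; omega)
    by_cases hx : insCoord i b x ∈ A
    · by_cases hk : outDegree A (insCoord i b x) = k
      · rw [hk] at hm
        simp only [mem_cubeSlice, hx]
        norm_num [hk]
        linarith
      · simp only [mem_cubeSlice, hx]
        norm_num [hk]
        linarith
    · simp [mem_cubeSlice, hx]
  have := isoperimetric (cubeSlice i b A)
  have := cubeMeasure_nonneg (cubeSlice i b A)
  nlinarith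

/-- Slicing lowers the degree 2 to 1, except at points whose mirror image lies in the small slice.
-/
theorem NearSubcube.slice_not {n : ℕ} {A : Finset (Cube (n + 1))} {η : ℝ}
    (h : NearSubcube 2 A η) {i : Fin (n + 1)} {b : Bool}
    (hb : cubeMeasure (cubeSlice i (!b) A) ≤ 8 * η) : NearSubcube 1 (cubeSlice i b A) (22 * η) := by
  have h1 := abs_le.1 h.1
  have h0 := cubeMeasure_nonneg (cubeSlice i (!b) A)
  have e : cubeMeasure A = (cubeMeasure (cubeSlice i b A) + cubeMeasure (cubeSlice i (!b) A)) / 2 := by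
    have := cubeMeasure_succ i A
    cases b
    · simpa using this
    · simpa [add_comm] using this
  refine ⟨?_, ?_⟩
  · norm_num at h1 ⊢
    rw [abs_le]
    constructor <;> linarith
  · have h2 := h.2
    rw [cubeAvg_succ i] at h2
    have h3 : ∀ c : Bool, 0 ≤ cubeAvg fun x => if insCoord i c x ∈ A ∧
        outDegree A (insCoord i c x) ≠ 2 then 1 + degWeight (outDegree A (insCoord i c x)) else 0 :=
      fun c => cubeAvg_nonneg fun x => by
        have := degWeight_nonneg (outDegree A (insCoord i c x))
        split_ifs <;> linarith
    have h4 : (cubeAvg fun x => if insCoord i b x ∈ A ∧ outDegree A (insCoord i b x) ≠ 2 then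
        1 + degWeight (outDegree A (insCoord i b x)) else 0) ≤ 2 * η := by
      have hf := h3 false
      have ht := h3 true
      cases b <;> linarith
    -- An exceptional point that keeps degree 2 costs 1 + 2^β = 5/2.
    refine le_trans ?_ (by linarith : 2 * η + 5 / 2 * cubeMeasure (cubeSlice i (!b) A) ≤ 22 * η)
    refine le_trans ?_ (add_le_add_left h4 _)
    rw [cubeMeasure_eq_avg, ← cubeAvg_const_mul, ← cubeAvg_add]
    refine cubeAvg_mono fun x => ?_
    rw [outDegree_insCoord]
    have hm := degWeight_mono (Nat.le_succ (outDegree (cubeSlice i b A) x))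
    have hn := degWeight_nonneg (outDegree (cubeSlice i b A) x)
    rw [Nat.succ_eq_add_one] at hm
    simp only [mem_cubeSlice]
    by_cases hx : insCoord i b x ∈ A
    · by_cases hx' : insCoord i (!b) x ∈ A
      · by_cases hk : outDegree (cubeSlice i b A) x = 2
        · norm_num [hx, hx', hk, degWeight_two]
        · simp only [hx, hx', if_true, add_zero]
          split_ifs <;> simp_all <;> linarith
      · by_cases hk : outDegree (cubeSlice i b A) x = 1
        · simp [hx, hx', hk]
        · simp [hx, hx', hk, hm]
    · simp only [hx, false_and, if_false, zero_add]
      split_ifs <;> norm_num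

/-! ### Building the subcube -/

theorem exists_isSubcube {n k : ℕ} (h : k ≤ n) : ∃ C : Finset (Cube n), IsSubcube k C := by
  obtain ⟨I, -, hI⟩ := Finset.exists_subset_card_eq (s := (Finset.univ : Finset (Fin n)))
    (n := k) (by simpa using h)
  exact ⟨_, I, hI, fun _ => false, rfl⟩

/-- The subcube `{x | x i = b, x restricted to the other coordinates in C}`. -/
def extendSet {n : ℕ} (i : Fin (n + 1)) (b : Bool) (C : Finset (Cube n)) :
    Finset (Cube (n + 1)) :=
  Finset.univ.filter fun x => x i = b ∧ (fun j => x (i.succAbove j)) ∈ C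

theorem isSubcube_extendSet {n k : ℕ} (i : Fin (n + 1)) (b : Bool) {C : Finset (Cube n)}
    (hC : IsSubcube k C) : IsSubcube (k + 1) (extendSet i b C) := by
  obtain ⟨I, hI, z, rfl⟩ := hC
  have hi : i ∉ I.map (Fin.succAboveEmb i) := by
    simp [Fin.succAbove_ne]
  refine ⟨insert i (I.map (Fin.succAboveEmb i)), ?_,
    fun j => insCoord i b (fun l => if h : l ∈ I then z ⟨l, h⟩ else false) j, ?_⟩
  · rw [Finset.card_insert_of_notMem hi, Finset.card_map, hI]
  · ext x
    simp only [extendSet, Finset.mem_filter, Finset.mem_univ, true_and, Subtype.forall,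
      Finset.mem_insert, forall_eq_or_imp, Finset.mem_map, insCoord_same]
    refine and_congr Iff.rfl ⟨?_, fun h a ha => ?_⟩
    · rintro h _ ⟨a, ha, rfl⟩
      have := h a ha
      simp [insCoord, ha, this]
    · have := h (i.succAbove a) ⟨a, ha, rfl⟩
      rw [this]
      simp [insCoord, ha]

theorem cubeSlice_extendSet_same {n : ℕ} (i : Fin (n + 1)) (b : Bool) (C : Finset (Cube n)) :
    cubeSlice i b (extendSet i b C) = C := by
  ext x
  simp [mem_cubeSlice, extendSet, insCoord]

theorem cubeSlice_extendSet_not {n : ℕ} (i : Fin (n + 1)) (b : Bool) (C : Finset (Cube n)) :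
    cubeSlice i (!b) (extendSet i b C) = ∅ := by
  ext x
  simp [mem_cubeSlice, extendSet, insCoord]

theorem cubeSlice_symmDiff {n : ℕ} (i : Fin (n + 1)) (b : Bool) (C A : Finset (Cube (n + 1))) :
    cubeSlice i b (symmDiff C A) = symmDiff (cubeSlice i b C) (cubeSlice i b A) := by
  ext x
  simp [mem_cubeSlice, Finset.mem_symmDiff]

theorem measure_symmDiff_extendSet {n : ℕ} (i : Fin (n + 1)) (b : Bool) (C : Finset (Cube n))
    (A : Finset (Cube (n + 1))) : cubeMeasure (symmDiff (extendSet i b C) A) =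
      (cubeMeasure (symmDiff C (cubeSlice i b A)) + cubeMeasure (cubeSlice i (!b) A)) / 2 := by
  rw [cubeMeasure_succ i]
  have hs := cubeSlice_symmDiff i b (extendSet i b C) A
  have hn := cubeSlice_symmDiff i (!b) (extendSet i b C) A
  rw [cubeSlice_extendSet_same] at hs
  rw [cubeSlice_extendSet_not, ← Finset.bot_eq_empty, bot_symmDiff] at hn
  rw [← hs, ← hn]
  cases b
  · rfl
  · rw [add_comm]; rfl

theorem cubeMeasure_compl {n : ℕ} (A : Finset (Cube n)) : cubeMeasure Aᶜ = 1 - cubeMeasure A := by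
  simp only [cubeMeasure, Finset.card_compl]
  rw [Nat.cast_sub (Finset.card_le_univ A), sub_div]
  simp

theorem NearSubcube.exists_codim_one {n : ℕ} (hn : 1 ≤ n) {A : Finset (Cube n)} {η : ℝ}
    (h : NearSubcube 1 A η) :
    ∃ C : Finset (Cube n), IsSubcube 1 C ∧ cubeMeasure (symmDiff C A) ≤ 10000 * η := by
  -- For larger η the bound is at least 1 and any subcube works.
  rcases le_total η (1 / 10000) with hη | hη
  · obtain ⟨n, rfl⟩ : ∃ m, n = m + 1 := ⟨n - 1, by omega⟩
    obtain ⟨i, b, hb⟩ := exists_slice_le (Or.inl rfl) h hη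
    have hb' := h.slice_le (Or.inl rfl) hb
    refine ⟨extendSet i (!b) Finset.univ, isSubcube_extendSet i _ ⟨∅, rfl, fun _ => false, by simp⟩,
      ?_⟩
    have e : cubeMeasure A =
        (cubeMeasure (cubeSlice i (!b) A) + cubeMeasure (cubeSlice i b A)) / 2 := by
      have := cubeMeasure_succ i A
      cases b
      · simpa [add_comm] using this
      · simpa using this
    have h1 := (abs_le.1 h.1).1
    have hc : symmDiff Finset.univ (cubeSlice i (!b) A) = (cubeSlice i (!b) A)ᶜ := by
      ext; simp [Finset.mem_symmDiff]
    rw [measure_symmDiff_extendSet, Bool.not_not, hc, cubeMeasure_compl]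
    norm_num at h1
    have := cubeMeasure_nonneg (cubeSlice i b A)
    linarith
  · obtain ⟨C, hC⟩ := exists_isSubcube hn
    exact ⟨C, hC, (cubeMeasure_le_one _).trans (by linarith)⟩

theorem NearSubcube.exists_codim_two {n : ℕ} (hn : 2 ≤ n) {A : Finset (Cube n)} {η : ℝ}
    (h : NearSubcube 2 A η) :
    ∃ C : Finset (Cube n), IsSubcube 2 C ∧ cubeMeasure (symmDiff C A) ≤ 120000 * η := by
  rcases le_total η (1 / 10000) with hη | hη
  · obtain ⟨n, rfl⟩ : ∃ m, n = m + 1 := ⟨n - 1, by omega⟩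
    obtain ⟨i, b, hb⟩ := exists_slice_le (Or.inr rfl) h hη
    have hb' := h.slice_le (Or.inr rfl) hb
    -- The resulting constant is (10000 · 22 + 8)/2 < 120000.
    obtain ⟨C, hC, hCA⟩ := (h.slice_not (i := i) (b := !b) (by simpa using hb')).exists_codim_one
      (by omega)
    refine ⟨extendSet i (!b) C, isSubcube_extendSet i _ hC, ?_⟩
    rw [measure_symmDiff_extendSet, Bool.not_not]
    have := cubeMeasure_nonneg (cubeSlice i b A)
    linarith
  · obtain ⟨C, hC⟩ := exists_isSubcube hn
    exact ⟨C, hC, (cubeMeasure_le_one _).trans (by linarith)⟩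

/-! ### From the edge count to a near-subcube -/

theorem hammingDist_flipCoord {n : ℕ} (x : Cube n) (i : Fin n) :
    hammingDist x (flipCoord x i) = 1 := by
  rw [hammingDist, Finset.card_eq_one]
  refine ⟨i, ?_⟩
  ext j
  rw [Finset.mem_filter, Finset.mem_singleton]
  by_cases h : j = i
  · subst h; simp [flipCoord]
  · simp [flipCoord, h]

theorem flipCoord_injective {n : ℕ} (x : Cube n) : Function.Injective (flipCoord x) := by
  intro i j h
  by_contra hij
  have := congrFun h i
  simp [flipCoord, Function.update_of_ne hij] at this

theorem IsCubePartition.notMem_union_iff {n : ℕ} {A B W : Finset (Cube n)}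
    (h : IsCubePartition A B W) (x : Cube n) : x ∉ A ∪ W ↔ x ∈ B := by
  obtain ⟨h1, -, h3, h4⟩ := h
  have hx : x ∈ A ∪ B ∪ W := h4 ▸ Finset.mem_univ x
  have h1' : x ∈ A → x ∉ B := fun h => Finset.disjoint_left.1 h1 h
  have h3' : x ∈ B → x ∉ W := fun h => Finset.disjoint_left.1 h3 h
  simp only [Finset.mem_union] at *
  tauto

theorem sum_outDegree_le {n : ℕ} {A B W : Finset (Cube n)} (h : IsCubePartition A B W) :
    ∑ x ∈ A, outDegree (A ∪ W) x ≤ (edgesBetween A B).card := by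
  have e : ∑ x ∈ A, outDegree (A ∪ W) x =
      (A.sigma fun x => Finset.univ.filter fun i => flipCoord x i ∈ B).card := by
    rw [Finset.card_sigma]
    refine Finset.sum_congr rfl fun x _ => ?_
    rw [outDegree, Finset.card_filter]
    refine Finset.sum_congr rfl fun i _ => ?_
    have := h.notMem_union_iff (flipCoord x i)
    by_cases hB : flipCoord x i ∈ B
    · rw [if_pos hB, if_neg (this.2 hB)]
    · rw [if_neg hB, if_pos (not_not.1 (mt this.1 hB))]
  rw [e]
  refine Finset.card_le_card_of_injOn (fun p => (p.1, flipCoord p.1 p.2)) ?_ ?_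
  · rintro ⟨x, i⟩ hp
    simp only [Finset.mem_coe, Finset.mem_sigma, Finset.mem_filter, Finset.mem_univ,
      true_and] at hp
    simp only [edgesBetween, Finset.mem_coe, Finset.mem_filter, Finset.mem_product]
    exact ⟨hp, hammingDist_flipCoord x i⟩
  · rintro ⟨x, i⟩ - ⟨y, j⟩ - hp
    simp only [Prod.mk.injEq] at hp
    obtain ⟨rfl, hp⟩ := hp
    rw [flipCoord_injective x hp]

theorem outDegree_le {n : ℕ} (A : Finset (Cube n)) (x : Cube n) : outDegree A x ≤ n := by
  refine (Finset.sum_le_card_nsmul _ _ 1 fun i _ => ?_).trans (by simp)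
  split_ifs <;> norm_num

theorem exists_tangent {k : ℕ} (hk : k = 1 ∨ k = 2) : ∃ s : ℝ, 0 ≤ s ∧ s ≤ 1 ∧ ∀ h : ℕ,
    (if h ≠ k then 1 + degWeight h else 0) ≤
      120 * (degWeight k + s * ((h : ℝ) - k) - degWeight h) := by
  rcases hk with rfl | rfl
  · refine ⟨3 / 4, by norm_num, by norm_num, fun h => ?_⟩
    split_ifs with hh
    · have := degWeight_tangent_one hh
      rw [degWeight_one]; push_cast; linarith
    · rw [not_not.1 hh]; simp
  · refine ⟨19 / 40, by norm_num, by norm_num, fun h => ?_⟩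
    split_ifs with hh
    · have := degWeight_tangent_two hh
      rw [degWeight_two]; push_cast; linarith
    · rw [not_not.1 hh]; simp

theorem cubeMeasure_union {n : ℕ} {A W : Finset (Cube n)} (h : Disjoint A W) :
    cubeMeasure (A ∪ W) = cubeMeasure A + cubeMeasure W := by
  simp only [cubeMeasure, Finset.card_union_of_disjoint h]
  push_cast
  ring

theorem cubeMeasure_mono {n : ℕ} {A B : Finset (Cube n)} (h : A ⊆ B) :
    cubeMeasure A ≤ cubeMeasure B :=
  div_le_div_of_nonneg_right (by exact_mod_cast Finset.card_le_card h) (by positivity)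

/-- Outer neighbours of A ∪ W lie in B, so the edge hypothesis controls the mean of h on A. The
touching line turns this into an upper bound for the functional minus the deviation `X`, and
isoperimetry bounds the functional from below. -/
theorem nearSubcube_union {k n : ℕ} (hk : k = 1 ∨ k = 2) (hkn : k ≤ n) {ε : ℝ}
    {A B W : Finset (Cube n)} (h : IsCubePartition A B W)
    (hA1 : (1 - ε) * ((2 : ℝ) ^ k)⁻¹ ≤ cubeMeasure A)
    (hA2 : cubeMeasure A ≤ (1 + ε) * ((2 : ℝ) ^ k)⁻¹)
    (hW1 : cubeMeasure W ≤ ε) (hW2 : cubeMeasure W * degWeight n ≤ ε)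
    (hE : ((edgesBetween A B).card : ℝ) < (1 + ε) * (k : ℝ) * (2 : ℝ) ^ (n - k)) :
    NearSubcube k (A ∪ W) (800 * ε) := by
  have hW0 := cubeMeasure_nonneg W
  have hε : 0 ≤ ε := hW0.trans hW1
  have hdisj := h.2.1
  have hμ := cubeMeasure_union hdisj
  have hmem : ∀ x, x ∈ W → x ∉ A := fun x hx hx' => Finset.disjoint_left.1 hdisj hx' hx
  have hρ : ∀ x, degWeight (outDegree (A ∪ W) x) ≤ degWeight n := fun x =>
    degWeight_mono (outDegree_le _ x)
  obtain ⟨s, hs0, hs1, hs⟩ := exists_tangent hk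
  set H := cubeAvg fun x => if x ∈ A then (outDegree (A ∪ W) x : ℝ) else 0 with hH
  set R := cubeAvg fun x => if x ∈ A then degWeight (outDegree (A ∪ W) x) else 0 with hR
  set X := cubeAvg fun x => if x ∈ A ∧ outDegree (A ∪ W) x ≠ k then
    1 + degWeight (outDegree (A ∪ W) x) else 0 with hX
  have hH1 : H ≤ (1 + ε) * k * ((2 : ℝ) ^ k)⁻¹ := by
    have e1 : H = ((∑ x ∈ A, outDegree (A ∪ W) x : ℕ) : ℝ) / 2 ^ n := by
      simp [hH, cubeAvg, Finset.sum_ite_mem]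
    have e2 : (2 : ℝ) ^ n = 2 ^ (n - k) * 2 ^ k := by rw [← pow_add, Nat.sub_add_cancel hkn]
    have e3 : ((∑ x ∈ A, outDegree (A ∪ W) x : ℕ) : ℝ) ≤ (edgesBetween A B).card := by
      exact_mod_cast sum_outDegree_le h
    rw [e1, div_le_iff₀ (by positivity), e2]
    calc _ ≤ _ := e3.trans hE.le
      _ = _ := by field_simp
  have hR1 : isoFunctional (A ∪ W) ≤ R + ε := by
    refine le_trans ?_ (add_le_add_right hW2 R)
    rw [hR, cubeMeasure_eq_avg, ← cubeAvg_mul_const, ← cubeAvg_add]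
    refine cubeAvg_mono fun x => ?_
    have := hρ x
    have := degWeight_nonneg n
    by_cases hx : x ∈ A <;> by_cases hw : x ∈ W <;> simp [hx, hw] <;> linarith
  have hX1 : X ≤ 120 * (degWeight k * cubeMeasure A + s * (H - k * cubeMeasure A) - R) := by
    rw [hX, hH, hR, cubeMeasure_eq_avg]
    simp only [← cubeAvg_const_mul, ← cubeAvg_add, ← cubeAvg_sub]
    refine cubeAvg_mono fun x => ?_
    have := hs (outDegree (A ∪ W) x)
    by_cases hx : x ∈ A
    · simpa [hx] using this
    · simp [hx]
  have hX2 : (cubeAvg fun x => if x ∈ A ∪ W ∧ outDegree (A ∪ W) x ≠ k then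
      1 + degWeight (outDegree (A ∪ W) x) else 0) ≤ X + cubeMeasure W * (1 + degWeight n) := by
    rw [hX, cubeMeasure_eq_avg, ← cubeAvg_mul_const, ← cubeAvg_add]
    refine cubeAvg_mono fun x => ?_
    have := hρ x
    have := degWeight_nonneg n
    by_cases hx : x ∈ A <;> by_cases hw : x ∈ W <;> by_cases hd : outDegree (A ∪ W) x = k <;>
      simp [hx, hw, hd] <;> linarith
  have hiso := isoperimetric (A ∪ W)
  have hle := cubeMeasure_le_one (A ∪ W)
  have hnn := cubeMeasure_nonneg A
  rw [hμ] at hiso hle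
  have hsl : s * (H - k * cubeMeasure A) ≤ 1 * ε := by
    -- The excess is at most 2kε·2^(-k), which is ε for both values of k.
    have : H - k * cubeMeasure A ≤ ε := by
      rcases hk with rfl | rfl <;> norm_num at hH1 hA1 ⊢ <;> linarith
    exact (mul_le_mul_of_nonneg_left this hs0).trans (mul_le_mul_of_nonneg_right hs1 hε)
  set a := cubeMeasure A
  set w := cubeMeasure W
  rw [NearSubcube, hμ]
  rcases hk with rfl | rfl
  · norm_num [degWeight_one] at *
    refine ⟨abs_le.2 ⟨by linarith, by linarith⟩, hX2.trans ?_⟩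
    have : 1 / 2 - 2 * ε ≤ 2 * (a + w) * (1 - (a + w)) := by
      rcases le_total (a + w) (1 / 2) with hc | hc <;> nlinarith
    linarith
  · norm_num [degWeight_two] at *
    refine ⟨abs_le.2 ⟨by linarith, by linarith⟩, hX2.trans ?_⟩
    have : 3 / 8 - 4 * ε ≤ 2 * (a + w) * (1 - (a + w)) := by
      rcases le_total (a + w) (1 / 4) with hc | hc <;> nlinarith
    linarith

/-! ### Directional boundaries and conclusion -/

theorem card_dirBoundary {n : ℕ} (i : Fin n) (A : Finset (Cube n)) :
    ((dirBoundary i A).card : ℝ) = cubeAvg (fun x => if x ∈ A ∧ flipCoord x i ∉ A then 1 else 0) *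
      2 ^ n := by
  rw [dirBoundary, Finset.card_image_of_injective _ fun x y h => (Prod.mk.inj h).1, cubeAvg,
    div_mul_cancel₀ _ (by positivity), Finset.sum_boole]
  congr 2
  ext x
  simp

theorem abs_card_dirBoundary_sub_le {n : ℕ} (i : Fin n) (A C : Finset (Cube n)) :
    |((dirBoundary i A).card : ℝ) - (dirBoundary i C).card| ≤
      2 * cubeMeasure (symmDiff C A) * 2 ^ n := by
  have e : 2 * cubeMeasure (symmDiff C A) = cubeAvg fun x =>
      (if x ∈ symmDiff C A then 1 else 0) + (if flipCoord x i ∈ symmDiff C A then 1 else 0) := by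
    rw [cubeAvg_add, cubeMeasure_eq_avg, two_mul]
    congr 1
    exact (cubeAvg_equiv (flipEquiv i) fun x => if x ∈ symmDiff C A then (1 : ℝ) else 0).symm
  rw [card_dirBoundary, card_dirBoundary, ← sub_mul, abs_mul, abs_of_pos (a := (2 : ℝ) ^ n)
    (by positivity), e, ← cubeAvg_sub]
  refine mul_le_mul_of_nonneg_right ?_ (by positivity)
  rw [abs_le, ← neg_one_mul, ← cubeAvg_const_mul]
  constructor <;>
  · refine cubeAvg_mono fun x => ?_
    simp only [Finset.mem_symmDiff]
    by_cases h1 : x ∈ A <;> by_cases h2 : x ∈ C <;> by_cases h3 : flipCoord x i ∈ A <;>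
      by_cases h4 : flipCoord x i ∈ C <;> simp [h1, h2, h3, h4] <;> norm_num

theorem IsSubcube.card_dirBoundary {n k : ℕ} {C : Finset (Cube n)} (hC : IsSubcube k C) :
    ∃ I : Finset (Fin n), I.card = k ∧ ∀ i ∈ I, (dirBoundary i C).card = 2 ^ (n - k) := by
  obtain ⟨I, hI, z, hz⟩ := hC
  refine ⟨I, hI, fun i hi => ?_⟩
  have hf : (C.filter fun x => flipCoord x i ∉ C) = C := by
    refine Finset.filter_true_of_mem fun x hx hx' => ?_
    rw [hz] at hx hx'
    simp only [Finset.mem_filter, Finset.mem_univ, true_and] at hx hx'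
    have h1 := hx ⟨i, hi⟩
    have h2 := hx' ⟨i, hi⟩
    simp [flipCoord, h1] at h2
  rw [dirBoundary, Finset.card_image_of_injective _ fun x y h => (Prod.mk.inj h).1, hf]
  -- As a product, C has one choice on I and two off it.
  have hp : C = Fintype.piFinset fun j => if h : j ∈ I then {z ⟨j, h⟩} else Finset.univ := by
    ext x
    simp only [hz, Finset.mem_filter, Finset.mem_univ, true_and, Fintype.mem_piFinset,
      Subtype.forall]
    refine forall_congr' fun j => ?_
    by_cases hj : j ∈ I <;> simp [hj]
  rw [hp, Fintype.card_piFinset]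
  have : ∀ j, (if h : j ∈ I then {z ⟨j, h⟩} else (Finset.univ : Finset Bool)).card =
      if j ∈ I then 1 else 2 := fun j => by by_cases hj : j ∈ I <;> simp [hj]
  simp only [this, Finset.prod_ite, Finset.prod_const, one_pow, one_mul]
  congr 1
  have := Finset.card_compl I
  rw [hI, Fintype.card_fin] at this
  rw [← this]
  congr 1
  ext; simp

theorem theorem1p8 :
    ∃ K : ℝ, 0 < K ∧
      ∀ k : ℕ, (k = 1 ∨ k = 2) →
      ∀ n : ℕ, k ≤ n →
      ∀ ε : ℝ, 0 < ε →
      ∀ A B W : Finset (Cube n),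
        IsCubePartition A B W →
        (1 - ε) * ((2 : ℝ) ^ k)⁻¹ ≤ cubeMeasure A →
        cubeMeasure A ≤ (1 + ε) * ((2 : ℝ) ^ k)⁻¹ →
        cubeMeasure W ≤ ε * (n : ℝ) ^ (-isoBeta) →
        ((edgesBetween A B).card : ℝ) < (1 + ε) * (k : ℝ) * (2 : ℝ) ^ (n - k) →
        (∃ I : Finset (Fin n), I.card = k ∧
          ∀ i ∈ I, |((dirBoundary i A).card : ℝ) - (2 : ℝ) ^ (n - k)| ≤
            K * ε * (2 : ℝ) ^ (n - k)) ∧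
        (∃ C : Finset (Cube n), IsSubcube k C ∧
          cubeMeasure (symmDiff C A) ≤ K * ε) := by
  -- Here 120000 · 800 + 1 ≤ 10^8, and passing to boundaries costs 2 · 2^k ≤ 8.
  refine ⟨10 ^ 9, by norm_num, fun k hk n hkn ε hε A B W h hA1 hA2 hW hE => ?_⟩
  have hn : (1 : ℝ) ≤ n := by exact_mod_cast (by omega : 1 ≤ n)
  have hn0 : (0 : ℝ) < n := by linarith
  have hW1 : cubeMeasure W ≤ ε := hW.trans (mul_le_of_le_one_right hε.le
    (Real.rpow_le_one_of_one_le_of_nonpos hn (by linarith [isoBeta_pos])))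
  have hW2 : cubeMeasure W * degWeight n ≤ ε := by
    refine (mul_le_mul_of_nonneg_right hW (degWeight_nonneg n)).trans_eq ?_
    rw [degWeight, mul_assoc, ← Real.rpow_add hn0]
    simp
  have hnear := nearSubcube_union hk hkn h hA1 hA2 hW1 hW2 hE
  obtain ⟨C, hC, hCA⟩ : ∃ C : Finset (Cube n), IsSubcube k C ∧
      cubeMeasure (symmDiff C (A ∪ W)) ≤ 120000 * (800 * ε) := by
    rcases hk with rfl | rfl
    · obtain ⟨C, hC, hCA⟩ := hnear.exists_codim_one hkn
      exact ⟨C, hC, by linarith⟩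
    · exact hnear.exists_codim_two hkn
  have hCA' : cubeMeasure (symmDiff C A) ≤ 10 ^ 8 * ε := by
    have hsub : symmDiff C A ⊆ symmDiff C (A ∪ W) ∪ W := fun x => by
      simp only [Finset.mem_symmDiff, Finset.mem_union]
      tauto
    have hu : cubeMeasure (symmDiff C (A ∪ W) ∪ W) ≤
        cubeMeasure (symmDiff C (A ∪ W)) + cubeMeasure W := by
      rw [cubeMeasure, cubeMeasure, cubeMeasure, ← add_div]
      exact div_le_div_of_nonneg_right (by exact_mod_cast Finset.card_union_le _ _)
        (by positivity)
    have := cubeMeasure_mono hsub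
    linarith
  refine ⟨?_, C, hC, by linarith⟩
  obtain ⟨I, hI, hcard⟩ := hC.card_dirBoundary
  refine ⟨I, hI, fun i hi => ?_⟩
  have hd := abs_card_dirBoundary_sub_le i A C
  rw [hcard i hi] at hd
  push_cast at hd
  refine hd.trans ?_
  have e : (2 : ℝ) ^ n = 2 ^ k * 2 ^ (n - k) := by rw [← pow_add, Nat.add_sub_cancel' hkn]
  have hk4 : (2 : ℝ) ^ k ≤ 4 := by rcases hk with rfl | rfl <;> norm_num
  rw [e, ← mul_assoc]
  refine mul_le_mul_of_nonneg_right ?_ (by positivity)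
  calc _ ≤ 2 * (10 ^ 8 * ε) * 4 := by gcongr
    _ ≤ _ := by linarith
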